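/- Let $p$ be a prime and let $G$ be a finite group with a split $BN$-pair of characteristic $p$ (for instance, a finite group of Lie type defined in characteristic $p$). That is, $G=\langle B,N\rangle$ has a $BN$-pair $(B,N)$ with torus $T=B\cap N$ and Weyl group $W=N/T$, generated by a set $S$ of involutions, such that $B=UT$, where $U=O_p(B)$ is the largest normal $p$-subgroup of $B$ and $T$ is abelian of order prime to $p$, and $\bigcap_{n\in N}nBn^{-1}=T$. Let $k$ be an algebraically closed field of characteristic $r>0$ with $r\neq p$. For $J\subseteq S$ let $P_J$ be the standard parabolic subgroup, $L_J\supseteq T$ its standard Levi subgroup, and let $\mathscr{L}_G=\{nL_Jn^{-1} : J\subseteq S,\ n\in N\}$. For $L=nL_Jn^{-1}\in\mathscr{L}_G$, $P=nP_Jn^{-1}$ and a $kG$-module $Y$, let ${}^*R^G_L(Y)=Y^{O_p(P)}$, regarded as a $kL$-module (Harish-Chandra restriction). For an irreducible $kT$-module $X$, the principal series ${\rm Irr}_k(G|(T,X))$ is the set of (isomorphism classes of) irreducible $kG$-modules $Y$ such that $T$ is minimal among the $L\in\mathscr{L}_G$ with ${}^*R^G_L(Y)\neq 0$, and $X$ is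 a composition factor of ${}^*R^G_T(Y)=Y^U$. Let $X$ and $X'$ be irreducible $kT$-modules with ${\rm Irr}_k(G|(T,X))\neq{\rm Irr}_k(G|(T,X'))$. If $Y\in{\rm Irr}_k(G|(T,X))$ and $V\in{\rm Irr}_k(G|(T,X'))$, then ${\rm Ext}^1_{kG}(Y,V)=0$. -/

import Mathlib

open CategoryTheory
open scoped Pointwise MonoidAlgebra

universe u v w

/-- A BN-pair (Tits system) in a group `G`: subgroups `B` and `N` generating `G`, with `B ∩ N`
normal in `N`, and a set `S` of involutions generating `W = N / (B ∩ N)`, subject to the usual two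
axioms, which are stated for all representatives in `N` of the elements of `S` and of `W`. -/
structure BNPair (G : Type v) [Group G] where
  B : Subgroup G
  N : Subgroup G
  sup_eq_top : B ⊔ N = ⊤
  [normal : ((B ⊓ N).subgroupOf N).Normal]
  S : Set (N ⧸ (B ⊓ N).subgroupOf N)
  orderOf_eq_two : ∀ s ∈ S, orderOf s = 2
  closure_eq_top : Subgroup.closure S = ⊤
  mul_mem : ∀ s n : N, (s : N ⧸ (B ⊓ N).subgroupOf N) ∈ S → ∀ b ∈ B,
    (s : G) * b * n ∈ DoubleCoset.doubleCoset ((s : G) * n) (B : Set G) B ∪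
      DoubleCoset.doubleCoset (n : G) (B : Set G) B
  conj_ne : ∀ s : N, (s : N ⧸ (B ⊓ N).subgroupOf N) ∈ S → MulAut.conj (s : G) • B ≠ B

attribute [instance] BNPair.normal

/-- The largest normal `p`-subgroup `O_p(H)` of a (finite) group `H`: the subgroup generated by all
normal `p`-subgroups. -/
def pCore (p : ℕ) (H : Type v) [Group H] : Subgroup H :=
  ⨆ K : {K : Subgroup H // K.Normal ∧ IsPGroup p K}, K.1

instance pCore_normal (p : ℕ) (H : Type v) [Group H] : (pCore p H).Normal := by
  refine ⟨fun x hx g => ?_⟩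
  have key : pCore p H ≤ (pCore p H).comap (MulAut.conj g).toMonoidHom := by
    refine iSup_le fun K y hy => ?_
    exact (le_iSup (fun K : {K : Subgroup H // K.Normal ∧ IsPGroup p K} => K.1) K)
      (K.2.1.conj_mem y hy g)
  exact key hx

namespace BNPair

variable {G : Type v} [Group G] (D : BNPair G)

/-- The maximal torus `T = B ∩ N`. -/
def T : Subgroup G := D.B ⊓ D.N

theorem T_le_B : D.T ≤ D.B := inf_le_left

/-- The Weyl group `W = N / T`. -/
abbrev W : Type v := D.N ⧸ (D.B ⊓ D.N).subgroupOf D.N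

/-- The unipotent radical `U = O_p(B)` of the Borel subgroup, as a subgroup of `G`. -/
def U (p : ℕ) : Subgroup G := (pCore p D.B).map D.B.subtype

/-- The BN-pair is split, of characteristic `p`: `B = UT` where `U` is the largest normal
`p`-subgroup of `B` and `T = B ∩ N` is an abelian `p'`-group, and the intersection of the
`N`-conjugates of `B` is `T`. -/
structure IsSplit (p : ℕ) : Prop where
  mul_eq : (D.U p : Set G) * (D.T : Set G) = D.B
  comm : ∀ a ∈ D.T, ∀ b ∈ D.T, a * b = b * a
  not_dvd : ¬ p ∣ Nat.card D.T
  iInf_conj : ⨅ n : D.N, MulAut.conj (n : G) • D.B = D.T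

/-- The preimage `N_J` in `N` of the subgroup `W_J = ⟨J⟩` of `W`. -/
def NJ (J : Set D.W) : Subgroup G :=
  ((Subgroup.closure J).comap (QuotientGroup.mk' ((D.B ⊓ D.N).subgroupOf D.N))).map D.N.subtype

/-- The pairs `(P, L)` where `P = ⁿP_J` with `P_J = ⟨B, N_J⟩ = B W_J B` a standard parabolic
subgroup, `n ∈ N`, and `L = ⁿL_J`, where the standard Levi subgroup `L_J` is the intersection of
`P_J` with the opposite parabolic subgroup `⟨B⁻, N_J⟩`. Here `B⁻ = ^{m}B` is the opposite Borel
subgroup, i.e. `m ∈ N` and `B ∩ B⁻ = T` (so `m` represents the longest element of `W`). -/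
def IsParabolicLevi (P L : Subgroup G) : Prop :=
  ∃ J ⊆ D.S, ∃ m ∈ D.N, D.B ⊓ MulAut.conj m • D.B = D.T ∧ ∃ n ∈ D.N,
    P = MulAut.conj n • (D.B ⊔ D.NJ J) ∧
    L = MulAut.conj n • ((D.B ⊔ D.NJ J) ⊓ ((MulAut.conj m • D.B) ⊔ D.NJ J))

variable {D} in
theorem IsParabolicLevi.le {P L : Subgroup G} (h : D.IsParabolicLevi P L) : L ≤ P := by
  obtain ⟨J, -, m, -, -, n, -, rfl, rfl⟩ := h
  exact Subgroup.pointwise_smul_le_pointwise_smul_iff.2 inf_le_left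

end BNPair

section HarishChandra

variable {k : Type u} [Field k] {G : Type v} [Group G]

/-- Harish-Chandra restriction `*R^G_{L ⊆ P}(Y) = Y^{U_P}`, with `U_P = O_p(P)`, as a
representation of `L`. -/
noncomputable def hcRestriction (p : ℕ) {P L : Subgroup G} (h : L ≤ P) (Y : Rep.{w} k G) :
    Rep.{w} k L :=
  Rep.res (Subgroup.inclusion h) ((Rep.res P.subtype Y).toInvariants (pCore p P))

/-- The irreducible representation `X` is a composition factor of `M`, i.e. a quotient of a
subrepresentation of `M`. -/
def IsCompositionFactor {H : Type v} [Group H] (X M : Rep.{w} k H) : Prop :=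
  X.ρ.IsIrreducible ∧ ∃ (A : Subrepresentation M.ρ)
    (f : A.toRepresentation.IntertwiningMap X.ρ), Function.Surjective f

/-- The Harish-Chandra series `Irr_k(G | (L, X))`, where `*R^G_L` is computed through the parabolic
subgroup `P` with Levi complement `L`: the irreducible `Y` such that `X` is a composition factor of
`*R^G_L(Y)` and `L` is minimal with `*R^G_L(Y) ≠ 0`. It is given as an isomorphism-closed class of
representations, so that equality of series is equality of the sets of isomorphism classes. -/
def hcSeries (p : ℕ) (D : BNPair G) {P L : Subgroup G} (h : L ≤ P) (X : Rep.{w} k L) :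
    Set (Rep.{w} k G) :=
  {Y | Y.ρ.IsIrreducible ∧
    (Nontrivial (hcRestriction p h Y) ∧
      ∀ (P' L' : Subgroup G) (h' : D.IsParabolicLevi P' L'), L' < L →
        Subsingleton (hcRestriction p h'.le Y)) ∧
    IsCompositionFactor X (hcRestriction p h Y)}

/-- The principal series `Irr_k(G | (T, X))`; here `T` is a Levi complement of `B = P_∅`. -/
def principalSeries (p : ℕ) (D : BNPair G) (X : Rep.{w} k D.T) : Set (Rep.{w} k G) :=
  hcSeries p D D.T_le_B X

end HarishChandra

/-! Let `m` be the part of `|T|` prime to `r`. A linear character `χ` of `T` gives a block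
idempotent of `kT`, built on the `m`-torsion of `T`. It commutes with the average over `U`, and the
product `f_χ` (`borelIdem`) is an idempotent of `kG` that cuts out the `χ`-block part of `Y^U`. Let
`χ`, `ψ` be the characters of `X`, `X'`.

If the restrictions of `ψ` and `χ` to the `m`-torsion are not conjugate under `N`, the Bruhat
decomposition gives `f_ψ kG f_χ = 0` (`borelIdem_mul_mul_borelIdem`). The projective module `kG f_χ`
maps onto `Y` and is killed by `f_ψ`, whereas `f_ψ V ≠ 0`. So the kernel has no nonzero map to the
simple module `V`, and `Ext¹` vanishes (`subsingleton_ext_one_of_idempotent`).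

If the restrictions are conjugate, the two series coincide. Indeed `X` occurs in `Y^U` exactly when
`f_χ Y ≠ 0`, and this nonvanishing passes to conjugates of `χ` one simple reflection at a time
(`exists_borelIdem_conjChar_ne_zero`). When the reflection moves the restricted character, a
quadratic Hecke relation makes the passage possible (`borelIdem_quadratic`); its coefficient is
nonzero because `r ≠ p`. -/

open MonoidAlgebra (of)

/-! ### Idempotents of linear characters. -/

section CharIdem

variable {k : Type u} [Field k] {G : Type v} [Group G] [Finite G]

/-- The element `|H|⁻¹ ∑_{h ∈ H} χ(h⁻¹) h` of the group algebra attached to a linear character `χ`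
of a subgroup `H`. It is an idempotent if `|H|` is invertible in `k`. -/
noncomputable def charIdem (H : Subgroup G) (χ : H →* k) : k[G] :=
  letI := Fintype.ofFinite H
  (Nat.card H : k)⁻¹ • ∑ h : H, χ h⁻¹ • of k G h

variable {H : Subgroup G}

theorem of_mul_charIdem (χ : H →* k) (h : H) :
    of k G h * charIdem H χ = χ h • charIdem H χ := by
  let := Fintype.ofFinite H
  simp only [charIdem, mul_smul_comm, Finset.mul_sum, smul_comm (χ h), ← map_mul]
  congr 1
  rw [Finset.smul_sum]
  refine Fintype.sum_equiv (Equiv.mulLeft h) _ _ fun x => ?_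
  have hx : χ h * χ (h * x)⁻¹ = χ x⁻¹ := by
    rw [mul_inv_rev, mul_comm, ← map_mul, inv_mul_cancel_right]
  change _ = χ h • χ (h * x)⁻¹ • of k G (h * x : G)
  rw [smul_smul, hx, map_mul]

theorem charIdem_mul_of (χ : H →* k) (h : H) :
    charIdem H χ * of k G h = χ h • charIdem H χ := by
  let := Fintype.ofFinite H
  simp only [charIdem, smul_mul_assoc, Finset.sum_mul, smul_comm (χ h), ← map_mul]
  congr 1
  rw [Finset.smul_sum]
  refine Fintype.sum_equiv (Equiv.mulRight h) _ _ fun x => ?_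
  rw [smul_smul, ← map_mul]
  simp

theorem charIdem_mul_eq_self (χ : H →* k) (hH : (Nat.card H : k) ≠ 0) {c : k[G]}
    (hc : ∀ h : H, of k G h * c = χ h • c) : charIdem H χ * c = c := by
  let := Fintype.ofFinite H
  simp only [charIdem, smul_mul_assoc, Finset.sum_mul, hc, smul_smul, ← map_mul]
  simp [← Nat.card_eq_fintype_card, ← Nat.cast_smul_eq_nsmul k, smul_smul, hH]

theorem charIdem_mul_self (χ : H →* k) (hH : (Nat.card H : k) ≠ 0) :
    charIdem H χ * charIdem H χ = charIdem H χ :=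
  charIdem_mul_eq_self χ hH (of_mul_charIdem χ)

/-- An element `x` of `H` placed between the two factors acts by `χ x` on the left one and by `ψ x`
on the right one. -/
theorem charIdem_mul_charIdem_of_ne {χ ψ : H →* k} (h : χ ≠ ψ) :
    charIdem H χ * charIdem H ψ = 0 := by
  obtain ⟨x, hx⟩ := DFunLike.ne_iff.1 h
  have h₁ : χ x • (charIdem H χ * charIdem H ψ) = ψ x • (charIdem H χ * charIdem H ψ) := by
    rw [← smul_mul_assoc, ← charIdem_mul_of, mul_assoc, of_mul_charIdem, mul_smul_comm]
  rw [← sub_eq_zero, ← sub_smul] at h₁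
  exact (smul_eq_zero.1 h₁).resolve_left (sub_ne_zero.2 hx)

theorem of_mul_charIdem_of_conj (χ : H →* k) {g : G} (φ : H ≃* H)
    (hφ : ∀ h : H, g * h = φ h * g) :
    of k G g * charIdem H χ = charIdem H (χ.comp φ.symm.toMonoidHom) * of k G g := by
  let := Fintype.ofFinite H
  simp only [charIdem, mul_smul_comm, smul_mul_assoc, Finset.mul_sum, Finset.sum_mul, ← map_mul]
  congr 1
  refine Fintype.sum_equiv φ.toEquiv _ _ fun x => ?_
  simp [hφ]

theorem charIdem_commute (χ : H →* k) {c : k[G]} (hc : ∀ h : H, Commute (of k G h) c) :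
    Commute (charIdem H χ) c := by
  let := Fintype.ofFinite H
  exact .smul_left (Commute.sum_left _ _ _ fun h _ => (hc h).smul_left _) _

/-- An automorphism of `H` induced by an element normalizing it. -/
noncomputable def conjEquiv {g : G} (hg : ∀ h ∈ H, g * h * g⁻¹ ∈ H) : H ≃* H :=
  MulEquiv.ofBijective
    ((((MulAut.conj g).toMonoidHom.comp H.subtype).codRestrict H fun h => hg h h.2))
    (Finite.injective_iff_bijective.1 fun x y hxy => by
      have := congrArg (fun z : H => (z : G)) hxy
      simpa using this)

@[simp]
theorem conjEquiv_apply {g : G} (hg : ∀ h ∈ H, g * h * g⁻¹ ∈ H) (h : H) :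
    (conjEquiv hg h : G) = g * h * g⁻¹ := rfl

theorem mul_eq_conjEquiv_mul {g : G} (hg : ∀ h ∈ H, g * h * g⁻¹ ∈ H) (h : H) :
    g * h = conjEquiv hg h * g := by
  simp

theorem coe_conjEquiv_symm {g : G} (hg : ∀ h ∈ H, g * h * g⁻¹ ∈ H) (h : H) :
    ((conjEquiv hg).symm h : G) = g⁻¹ * h * g := by
  have := conjEquiv_apply hg ((conjEquiv hg).symm h)
  rw [MulEquiv.apply_symm_apply] at this
  rw [this]; group

end CharIdem

section PCore

/-- A Sylow `p`-subgroup contains every normal `p`-subgroup, hence the subgroup they generate. -/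
theorem isPGroup_pCore (p : ℕ) [Fact p.Prime] (H : Type v) [Group H] [Finite H] :
    IsPGroup p (pCore p H) := by
  obtain ⟨P⟩ := (inferInstance : Nonempty (Sylow p H))
  refine P.isPGroup'.to_le (iSup_le fun K => ?_)
  have := K.2.1
  exact K.2.2.le_sylow_of_normal P

end PCore

/-! ### The Bruhat decomposition and the structure of `B`. -/

namespace BNPair

variable {G : Type v} [Group G] {D : BNPair G}

theorem conj_mem_T {n t : G} (hn : n ∈ D.N) (ht : t ∈ D.T) : n * t * n⁻¹ ∈ D.T := by
  have := D.normal.conj_mem (⟨t, ht.2⟩ : D.N) (Subgroup.mem_subgroupOf.2 ht) ⟨n, hn⟩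
  exact Subgroup.mem_subgroupOf.1 this

theorem mk_eq_one_iff (n : D.N) : ((n : D.W) = 1) ↔ (n : G) ∈ D.T := by
  rw [QuotientGroup.eq_one_iff]; exact Subgroup.mem_subgroupOf

theorem mul_self_mem_T {n : D.N} (hn : (n : D.W) ∈ D.S) : (n * n : G) ∈ D.T := by
  have := pow_orderOf_eq_one (n : D.W)
  rw [D.orderOf_eq_two _ hn, pow_two, ← QuotientGroup.mk_mul, mk_eq_one_iff] at this
  simpa using this

/-- Induction on elements of `N`, through representatives of the simple reflections. -/
theorem N_induction {q : D.N → Prop} (torus : ∀ t : D.N, (t : G) ∈ D.T → q t)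
    (mul : ∀ s n : D.N, (s : D.W) ∈ D.S → q n → q (s * n)) (n : D.N) : q n := by
  have key : ∀ w : D.W, ∀ n : D.N, (n : D.W) = w → q n := by
    intro w
    have hw : w ∈ Subgroup.closure D.S := D.closure_eq_top ▸ Subgroup.mem_top w
    have step : ∀ s ∈ D.S, ∀ w : D.W, (∀ n : D.N, (n : D.W) = w → q n) →
        ∀ n : D.N, (n : D.W) = s * w → q n := by
      intro s hs w ih n hn
      obtain ⟨s, rfl⟩ := QuotientGroup.mk_surjective s
      have := mul s (s⁻¹ * n) hs (ih _ (by simp [hn]))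
      rwa [mul_inv_cancel_left] at this
    induction hw using Subgroup.closure_induction_left with
    | one => exact fun n hn => torus n ((mk_eq_one_iff n).1 hn)
    | mul_left s hs w _ ih => exact step s hs w ih
    | inv_mul_cancel s hs w _ ih =>
      have : s⁻¹ = s := by
        rw [inv_eq_iff_mul_eq_one, ← pow_two, ← D.orderOf_eq_two s hs, pow_orderOf_eq_one]
      rw [this]
      exact step s hs w ih
  exact key _ n rfl

/-- The Bruhat decomposition `G = BNB`. -/
theorem exists_mul_mul (D : BNPair G) (g : G) :
    ∃ b ∈ D.B, ∃ n : D.N, ∃ b' ∈ D.B, g = b * n * b' := by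
  -- The set `BNB` is stable under left multiplication by `N`; stability under `B` is clear, so it
  -- contains the group they generate.
  have hNl : ∀ (n : D.N) (g : G), (∃ b ∈ D.B, ∃ n : D.N, ∃ b' ∈ D.B, g = b * n * b') →
      ∃ b ∈ D.B, ∃ n' : D.N, ∃ b' ∈ D.B, n * g = b * n' * b' := by
    intro n
    induction n using N_induction with
    | torus t ht =>
      rintro _ ⟨b, hb, n, b', hb', rfl⟩
      exact ⟨t * b, D.B.mul_mem ht.1 hb, n, b', hb', by group⟩
    | mul s n hs ih =>
      intro g hg
      obtain ⟨b, hb, n', b', hb', h⟩ := ih g hg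
      rw [Subgroup.coe_mul, mul_assoc, h]
      rcases D.mul_mem s n' hs b hb with h | h <;>
        obtain ⟨c, hc, c', hc', h⟩ := DoubleCoset.mem_doubleCoset.1 h
      · exact ⟨c, hc, s * n', c' * b', D.B.mul_mem hc' hb', by
          rw [← mul_assoc, ← mul_assoc, h]; simp [mul_assoc]⟩
      · exact ⟨c, hc, n', c' * b', D.B.mul_mem hc' hb', by
          rw [← mul_assoc, ← mul_assoc, h]; simp [mul_assoc]⟩
  have hg : g ∈ Subgroup.closure ((D.B : Set G) ∪ D.N) := by
    rw [Subgroup.closure_union, Subgroup.closure_eq, Subgroup.closure_eq, D.sup_eq_top]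
    trivial
  have step : ∀ x ∈ (D.B : Set G) ∪ D.N, ∀ y,
      (∃ b ∈ D.B, ∃ n : D.N, ∃ b' ∈ D.B, y = b * n * b') →
      ∃ b ∈ D.B, ∃ n : D.N, ∃ b' ∈ D.B, x * y = b * n * b' := by
    rintro x (hx | hx) y hy
    · obtain ⟨b, hb, n, b', hb', rfl⟩ := hy
      exact ⟨x * b, D.B.mul_mem hx hb, n, b', hb', by group⟩
    · exact hNl ⟨x, hx⟩ y hy
  induction hg using Subgroup.closure_induction_left with
  | one => exact ⟨1, one_mem _, 1, 1, one_mem _, by simp⟩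
  | mul_left x hx y _ ih => exact step x hx y ih
  | inv_mul_cancel x hx y _ ih =>
    exact step x⁻¹ (hx.imp (fun h => inv_mem h) fun h => inv_mem h) y ih

section U

variable {p : ℕ}

theorem U_le_B (D : BNPair G) : D.U p ≤ D.B := Subgroup.map_subtype_le _

theorem conj_mem_U {b x : G} (hb : b ∈ D.B) (hx : x ∈ D.U p) : b * x * b⁻¹ ∈ D.U p := by
  obtain ⟨x, hx, rfl⟩ := hx
  exact ⟨_, (pCore_normal p D.B).conj_mem x hx ⟨b, hb⟩, rfl⟩

theorem mem_U_iff_mem_pCore {b : D.B} : (b : G) ∈ D.U p ↔ b ∈ pCore p D.B := by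
  simp [U]

/-- The elements of `p`-power order in `B` belong to `U`. -/
theorem IsSplit.mem_U_of_pow_eq_one (hD : D.IsSplit p) (hp : p.Prime) {b : G} (hb : b ∈ D.B)
    {j : ℕ} (hj : b ^ p ^ j = 1) : b ∈ D.U p := by
  have hb' := hb
  rw [← SetLike.mem_coe, ← hD.mul_eq] at hb'
  obtain ⟨x, hx, t, ht, rfl⟩ := hb'
  let b' : D.B := ⟨x * t, hb⟩
  let x' : D.B := ⟨x, U_le_B D hx⟩
  let t' : D.B := ⟨t, ht.1⟩
  -- Modulo `U` the element agrees with its `T`-component, so its order divides both `p ^ j` and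
  -- `|T|`, which are coprime.
  have h1 : (b' : D.B ⧸ pCore p D.B) = t' := by
    have : b' = x' * t' := rfl
    rw [this, QuotientGroup.mk_mul, (QuotientGroup.eq_one_iff x').2 (mem_U_iff_mem_pCore.1 hx),
      one_mul]
  have h2 : (b' : D.B ⧸ pCore p D.B) ^ p ^ j = 1 := by
    rw [← QuotientGroup.mk_pow, show b' ^ p ^ j = 1 from Subtype.ext hj]; rfl
  have h3 : (b' : D.B ⧸ pCore p D.B) ^ Nat.card D.T = 1 := by
    rw [h1, ← QuotientGroup.mk_pow, show t' ^ Nat.card D.T = 1 from Subtype.ext ?_]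
    · rfl
    · exact congrArg (fun z : D.T => (z : G)) (pow_card_eq_one' (x := (⟨t, ht⟩ : D.T)))
  have hco : Nat.Coprime (p ^ j) (Nat.card D.T) :=
    ((Nat.Prime.coprime_iff_not_dvd hp).2 hD.not_dvd).pow_left j
  have h4 : (b' : D.B ⧸ pCore p D.B) = 1 := by
    rw [← orderOf_eq_one_iff, ← Nat.dvd_one, ← hco]
    exact Nat.dvd_gcd (orderOf_dvd_of_pow_eq_one h2) (orderOf_dvd_of_pow_eq_one h3)
  exact mem_U_iff_mem_pCore (b := b').2 ((QuotientGroup.eq_one_iff b').1 h4)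

theorem isPGroup_U [Finite G] (hp : p.Prime) : IsPGroup p (D.U p) :=
  have := Fact.mk hp
  (isPGroup_pCore p D.B).map _

end U

end BNPair

theorem natCast_ne_zero_of_isPGroup {k : Type u} [Field k] {p r : ℕ} (hp : p.Prime) [CharP k r]
    (hr : r.Prime) (hrp : r ≠ p) {H : Type v} [Group H] [Finite H] (hH : IsPGroup p H) :
    (Nat.card H : k) ≠ 0 := by
  have := Fact.mk hp
  obtain ⟨j, hj⟩ := IsPGroup.iff_card.1 hH
  rw [hj, Ne, CharP.cast_eq_zero_iff k r]
  exact fun h => hrp ((Nat.prime_dvd_prime_iff_eq hr hp).1 (hr.dvd_of_dvd_pow h))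

/-! ### Conjugate characters of `T` and relations between their idempotents. -/

namespace BNPair

variable {G : Type v} [Group G] {D : BNPair G} {p : ℕ}

namespace IsSplit

/-- The `m`-torsion of the abelian group `T`. -/
def torsion (hD : D.IsSplit p) (m : ℕ) : Subgroup G where
  carrier := {t | t ∈ D.T ∧ t ^ m = 1}
  mul_mem' {a b} ha hb := ⟨D.T.mul_mem ha.1 hb.1, by
    rw [(show Commute a b from hD.comm a ha.1 b hb.1).mul_pow, ha.2, hb.2, one_mul]⟩
  one_mem' := ⟨D.T.one_mem, one_pow m⟩
  inv_mem' {a} ha := ⟨D.T.inv_mem ha.1, by rw [inv_pow, ha.2, inv_one]⟩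

theorem torsion_le (hD : D.IsSplit p) (m : ℕ) : hD.torsion m ≤ D.T := fun _ h => h.1

theorem conj_mem_torsion (hD : D.IsSplit p) (m : ℕ) {n t : G} (hn : n ∈ D.N)
    (ht : t ∈ hD.torsion m) : n * t * n⁻¹ ∈ hD.torsion m :=
  ⟨conj_mem_T hn ht.1, by rw [conj_pow, ht.2]; group⟩

theorem exists_mul_of_mem_B (hD : D.IsSplit p) {b : G} (hb : b ∈ D.B) :
    ∃ x ∈ D.U p, ∃ t ∈ D.T, b = x * t := by
  rw [← SetLike.mem_coe, ← hD.mul_eq] at hb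
  obtain ⟨x, hx, t, ht, rfl⟩ := hb
  exact ⟨x, hx, t, ht, rfl⟩

theorem exists_mul_of_mem_B' (hD : D.IsSplit p) {b : G} (hb : b ∈ D.B) :
    ∃ t ∈ D.T, ∃ x ∈ D.U p, b = t * x := by
  obtain ⟨x, hx, t, ht, h⟩ := hD.exists_mul_of_mem_B (inv_mem hb)
  exact ⟨t⁻¹, inv_mem ht, x⁻¹, inv_mem hx, by rw [← mul_inv_rev, ← h, inv_inv]⟩

end IsSplit

variable {k : Type u} [Field k] [Finite G]

/-- By Cauchy, if `r` divided this order, some element of order `r` would be killed by `m`, forcing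
`r ∣ m`. -/
theorem natCast_card_torsion_ne_zero {r : ℕ} [CharP k r] (hr : r.Prime) (hD : D.IsSplit p) {m : ℕ}
    (hm : (m : k) ≠ 0) : (Nat.card (hD.torsion m) : k) ≠ 0 := by
  rw [Ne, CharP.cast_eq_zero_iff k r] at hm ⊢
  intro h
  have := Fact.mk hr
  obtain ⟨x, hx⟩ := exists_prime_orderOf_dvd_card' r h
  exact hm (hx ▸ orderOf_dvd_of_pow_eq_one (Subtype.ext x.2.2))

/-- The conjugate of a linear character of `T` by an element of `N`. -/
noncomputable def conjChar (n : D.N) (χ : D.T →* k) : D.T →* k :=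
  χ.comp (conjEquiv (H := D.T) (g := n) fun _ => conj_mem_T n.2).symm.toMonoidHom

theorem conjChar_apply (n : D.N) (χ : D.T →* k) (t : D.T) :
    conjChar n χ t = χ ⟨(n : G)⁻¹ * t * n, by
      simpa using conj_mem_T (n⁻¹).2 t.2⟩ := by
  refine congrArg χ (Subtype.ext ?_)
  exact coe_conjEquiv_symm (H := D.T) (g := n) (fun _ => conj_mem_T n.2) t

theorem conjChar_mul (n n' : D.N) (χ : D.T →* k) :
    conjChar (n * n') χ = conjChar n (conjChar n' χ) := by
  ext t
  simp only [conjChar_apply]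
  congr 2
  simp [mul_assoc]

theorem IsSplit.conjChar_of_mem_T (hD : D.IsSplit p) {n : D.N} (hn : (n : G) ∈ D.T)
    (χ : D.T →* k) : conjChar n χ = χ := by
  ext t
  rw [conjChar_apply]
  congr 2
  rw [mul_assoc, hD.comm t t.2 n hn, inv_mul_cancel_left]

variable (D p k) in
/-- The idempotent `|U|⁻¹ ∑_{x ∈ U} x`. -/
noncomputable def unipIdem : k[G] := charIdem (D.U p) 1

theorem commute_of_unipIdem {b : G} (hb : b ∈ D.B) : Commute (of k G b) (unipIdem D p k) := by
  have hb' : ∀ x ∈ D.U p, b * x * b⁻¹ ∈ D.U p := fun _ => conj_mem_U hb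
  exact of_mul_charIdem_of_conj (k := k) (1 : D.U p →* k) (conjEquiv hb') (mul_eq_conjEquiv_mul hb')

theorem of_mul_unipIdem {x : G} (hx : x ∈ D.U p) :
    of k G x * unipIdem D p k = unipIdem D p k := by
  have := of_mul_charIdem (1 : D.U p →* k) ⟨x, hx⟩
  rwa [MonoidHom.one_apply, one_smul] at this

namespace IsSplit

variable (hD : D.IsSplit p) (m : ℕ)

/-- The restriction of a linear character of `T` to the `m`-torsion. -/
def resChar (χ : D.T →* k) : hD.torsion m →* k := χ.comp (Subgroup.inclusion (hD.torsion_le m))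

/-- The idempotent of `kT` attached to the restriction of `χ` to the `m`-torsion of `T`. If `m` is
the prime-to-`r` part of `|T|`, with `r = char k`, it is the block idempotent of `χ`. -/
noncomputable def torusIdem (χ : D.T →* k) : k[G] := charIdem (hD.torsion m) (hD.resChar m χ)

theorem of_mul_torusIdem (n : D.N) (χ : D.T →* k) :
    of k G n * hD.torusIdem m χ = hD.torusIdem m (conjChar n χ) * of k G n := by
  have hn : ∀ t ∈ hD.torsion m, (n : G) * t * (n : G)⁻¹ ∈ hD.torsion m :=
    fun _ => hD.conj_mem_torsion m n.2
  rw [torusIdem, of_mul_charIdem_of_conj _ (conjEquiv hn) (mul_eq_conjEquiv_mul hn), torusIdem]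
  congr 2
  ext t
  change χ _ = conjChar n χ _
  rw [conjChar_apply]
  exact congrArg χ (Subtype.ext (coe_conjEquiv_symm hn t))

theorem commute_of_torusIdem {t : G} (ht : t ∈ D.T) (χ : D.T →* k) :
    Commute (of k G t) (hD.torusIdem m χ) := by
  have := hD.of_mul_torusIdem m ⟨t, ht.2⟩ χ
  rwa [hD.conjChar_of_mem_T ht] at this

theorem commute_torusIdem_unipIdem (χ : D.T →* k) :
    Commute (hD.torusIdem m χ) (unipIdem D p k) :=
  charIdem_commute _ fun t => commute_of_unipIdem t.2.1.1

/-- The element of `kB` projecting a `kG`-module `Y` onto the part of `Y^U` that belongs to the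
block of `χ`. -/
noncomputable def borelIdem (χ : D.T →* k) : k[G] := hD.torusIdem m χ * unipIdem D p k

theorem commute_of_borelIdem {t : G} (ht : t ∈ D.T) (χ : D.T →* k) :
    Commute (of k G t) (hD.borelIdem m χ) :=
  (hD.commute_of_torusIdem m ht χ).mul_right (commute_of_unipIdem ht.1)

theorem borelIdem_mul_self {χ : D.T →* k} (hU : (Nat.card (D.U p) : k) ≠ 0)
    (hT : (Nat.card (hD.torsion m) : k) ≠ 0) :
    hD.borelIdem m χ * hD.borelIdem m χ = hD.borelIdem m χ := by
  rw [borelIdem, (hD.commute_torusIdem_unipIdem m χ).symm.mul_mul_mul_comm, torusIdem,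
    charIdem_mul_self _ hT, unipIdem, charIdem_mul_self _ hU]

theorem of_mul_borelIdem {x : G} (hx : x ∈ D.U p) (χ : D.T →* k) :
    of k G x * hD.borelIdem m χ = hD.borelIdem m χ := by
  rw [borelIdem, (hD.commute_torusIdem_unipIdem m χ).eq, ← mul_assoc, of_mul_unipIdem hx]

theorem borelIdem_mul_of {x : G} (hx : x ∈ D.U p) (χ : D.T →* k) :
    hD.borelIdem m χ * of k G x = hD.borelIdem m χ := by
  rw [borelIdem, mul_assoc, ← (commute_of_unipIdem (U_le_B D hx)).eq, of_mul_unipIdem hx]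

/-- Moving the torus idempotent of `χ` to the left across `n` conjugates it and puts it next to that
of `ψ`, to which it is orthogonal. -/
theorem borelIdem_mul_of_mul_borelIdem {n : D.N} {χ ψ : D.T →* k}
    (h : hD.resChar m ψ ≠ hD.resChar m (conjChar n χ)) :
    hD.borelIdem m ψ * of k G n * hD.borelIdem m χ = 0 := by
  rw [borelIdem, borelIdem, (hD.commute_torusIdem_unipIdem m ψ).eq, mul_assoc, mul_assoc,
    ← mul_assoc (of k G (n : G)), of_mul_torusIdem, ← mul_assoc (hD.torusIdem m ψ),
    ← mul_assoc (hD.torusIdem m ψ), torusIdem, torusIdem, charIdem_mul_charIdem_of_ne h]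
  simp

/-- With `b = x t` and `b' = t' x'`, the idempotents absorb the `U`-parts and commute with the
`T`-parts. -/
theorem borelIdem_mul_of_mul_borelIdem' {n : D.N} {χ ψ : D.T →* k}
    (h : hD.resChar m ψ ≠ hD.resChar m (conjChar n χ)) {b b' : G} (hb : b ∈ D.B) (hb' : b' ∈ D.B) :
    hD.borelIdem m ψ * of k G (b * n * b') * hD.borelIdem m χ = 0 := by
  obtain ⟨x, hx, t, ht, rfl⟩ := hD.exists_mul_of_mem_B hb
  obtain ⟨t', ht', x', hx', rfl⟩ := hD.exists_mul_of_mem_B' hb'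
  calc
    _ = (hD.borelIdem m ψ * of k G x) * of k G t * of k G n * of k G t' *
        (of k G x' * hD.borelIdem m χ) := by simp only [map_mul, mul_assoc]
    _ = (hD.borelIdem m ψ * of k G t) * of k G n * (of k G t' * hD.borelIdem m χ) := by
      rw [of_mul_borelIdem _ _ hx', borelIdem_mul_of _ _ hx]; simp only [mul_assoc]
    _ = of k G t * (hD.borelIdem m ψ * of k G n * hD.borelIdem m χ) * of k G t' := by
      rw [(hD.commute_of_borelIdem m ht' χ).eq, ← (hD.commute_of_borelIdem m ht ψ).eq]
      simp only [mul_assoc]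
    _ = 0 := by rw [hD.borelIdem_mul_of_mul_borelIdem m h, mul_zero, zero_mul]

/-- There are no homomorphisms between the projective modules attached to characters which are not
conjugate under `N`. -/
theorem borelIdem_mul_mul_borelIdem {χ ψ : D.T →* k}
    (h : ∀ n : D.N, hD.resChar m ψ ≠ hD.resChar m (conjChar n χ)) (c : k[G]) :
    hD.borelIdem m ψ * c * hD.borelIdem m χ = 0 := by
  induction c using MonoidAlgebra.induction_on with
  | of g =>
    obtain ⟨b, hb, n, b', hb', rfl⟩ := D.exists_mul_mul g
    exact hD.borelIdem_mul_of_mul_borelIdem' m (h n) hb hb'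
  | add x y hx hy => rw [mul_add, add_mul, hx, hy, add_zero]
  | smul a x hx => rw [mul_smul_comm, smul_mul_assoc, hx, smul_zero]

/-- The quadratic relation for a simple reflection in the Hecke algebra, cut down to a character
which is not fixed by the reflection. -/
theorem borelIdem_quadratic (hp : p.Prime) {χ : D.T →* k} {n : D.N} (hn : (n : D.W) ∈ D.S)
    (hU : (Nat.card (D.U p) : k) ≠ 0) (hT : (Nat.card (hD.torsion m) : k) ≠ 0)
    (h : hD.resChar m χ ≠ hD.resChar m (conjChar n χ)) :
    ∃ a : k, a ≠ 0 ∧ hD.borelIdem m χ * of k G n * unipIdem D p k * of k G n * hD.borelIdem m χ =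
      a • (of k G (n * n : G) * hD.borelIdem m χ) := by
  classical
  let := Fintype.ofFinite (D.U p)
  let K : Subgroup (D.U p) := ((D.U p).comap (MulAut.conj (n : G)).toMonoidHom).subgroupOf (D.U p)
  have hK : ∀ x : D.U p, x ∈ K ↔ (n : G) * x * (n : G)⁻¹ ∈ D.U p := fun x => by
    simp [K, Subgroup.mem_subgroupOf]
  have hK0 : (Nat.card K : k) ≠ 0 := fun h0 => hU <| by
    obtain ⟨c, hc⟩ := Subgroup.card_subgroup_dvd_card K
    rw [hc, Nat.cast_mul, h0, zero_mul]
  -- Here `K` is `U ∩ n⁻¹Un`, viewed inside `U`. Only its elements contribute to the average over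
  -- `U`.
  have hterm : ∀ x : D.U p, hD.borelIdem m χ * of k G (n * x * n) * hD.borelIdem m χ =
      if x ∈ K then of k G (n * n : G) * hD.borelIdem m χ else 0 := by
    intro x
    split_ifs with hx
    · rw [hK] at hx
      have : (n : G) * x * n = (n * x * (n : G)⁻¹) * (n * n) := by group
      rw [this, map_mul, ← mul_assoc, borelIdem_mul_of _ _ hx,
        ← (hD.commute_of_borelIdem m (mul_self_mem_T hn) χ).eq, mul_assoc,
        borelIdem_mul_self _ _ hU hT]
    -- Since `n * n` lies in `T`, the first double coset is `B`. Then `n x n⁻¹` is an element of `B`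
    -- of `p`-power order, hence in `U`, contrary to `x ∉ K`. On the second, `BnB`, the term
    -- vanishes because `n` moves the restriction of `χ`.
    · rcases D.mul_mem n n hn x (U_le_B D x.2) with hx' | hx' <;>
        obtain ⟨c, hc, c', hc', hx'⟩ := DoubleCoset.mem_doubleCoset.1 hx'
      · refine absurd ((hK x).2 ?_) hx
        have hB : (n : G) * x * (n : G)⁻¹ ∈ D.B := by
          have : (n : G) * x * (n : G)⁻¹ = (c * (n * n) * c') * (n * n : G)⁻¹ := by
            rw [← hx']; group
          rw [this]
          have hnn := (mul_self_mem_T hn).1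
          exact D.B.mul_mem (D.B.mul_mem (D.B.mul_mem hc hnn) hc') (D.B.inv_mem hnn)
        obtain ⟨j, hj⟩ := isPGroup_U hp x
        refine hD.mem_U_of_pow_eq_one hp hB (j := j) ?_
        have hj' : (x : G) ^ p ^ j = 1 := congrArg (fun z : D.U p => (z : G)) hj
        rw [conj_pow, hj']
        group
      · rw [hx']
        exact hD.borelIdem_mul_of_mul_borelIdem' m h hc hc'
  -- The coefficient is `|K| / |U|`: the normalising factor of the average times the number of
  -- surviving terms.
  refine ⟨(Nat.card (D.U p) : k)⁻¹ * Nat.card K, mul_ne_zero (inv_ne_zero hU) hK0, ?_⟩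
  calc
    _ = (Nat.card (D.U p) : k)⁻¹ •
        ∑ x : D.U p, hD.borelIdem m χ * of k G (n * x * n) * hD.borelIdem m χ := by
      simp only [unipIdem, charIdem, MonoidHom.one_apply, one_smul, mul_smul_comm, smul_mul_assoc,
        Finset.mul_sum, Finset.sum_mul, map_mul, mul_assoc]
    _ = _ := by
      simp only [hterm]
      rw [← Finset.sum_filter, Finset.sum_const, mul_smul, ← Nat.cast_smul_eq_nsmul k]
      congr 3
      rw [Nat.card_eq_fintype_card, Fintype.card_subtype]

end IsSplit

end BNPair

/-! ### Vanishing of `Ext¹` from idempotents. -/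

/-- If `f` is an idempotent and `f' R f = 0`, then there is no nonsplit extension of a simple module
`Y` with `f Y ≠ 0` by a simple module `V` with `f' V ≠ 0`: in the presentation of `Y` as a quotient
of the projective module `R f`, the kernel has no nonzero homomorphism to `V`. -/
theorem subsingleton_ext_one_of_idempotent {R : Type u} [Ring R] {f f' : R} (hf : f * f = f)
    (h : ∀ c, f' * c * f = 0) (Y V : ModuleCat.{u} R) [IsSimpleModule R Y] [IsSimpleModule R V]
    {y : Y} (hy : f • y ≠ 0) {v : V} (hv : f' • v ≠ 0) :
    Subsingleton (Abelian.Ext.{u} Y V 1) := by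
  let P : Submodule R R := R ∙ f
  have hP : ∀ x : P, (x : R) * f = x := fun x => by
    obtain ⟨c, hc⟩ := Submodule.mem_span_singleton.1 x.2
    rw [← hc, smul_eq_mul, mul_assoc, hf]
  have hf' : ∀ x : P, f' • x = 0 := fun x => Subtype.ext <| by
    rw [Submodule.coe_smul, smul_eq_mul, ← hP x, ← mul_assoc, h, Submodule.coe_zero]
  -- Right multiplication by `f` retracts `R` onto `P = R f`.
  have : Module.Projective R P := by
    refine Module.Projective.of_split P.subtype
      (LinearMap.codRestrict P (LinearMap.toSpanSingleton R R f)
        fun c => Submodule.mem_span_singleton.2 ⟨c, rfl⟩) ?_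
    ext x
    exact hP x
  let π : P →ₗ[R] Y := LinearMap.toSpanSingleton R Y y ∘ₗ P.subtype
  have hπ : Function.Surjective π := by
    refine LinearMap.surjective_of_ne_zero fun h0 => hy ?_
    exact LinearMap.congr_fun h0 ⟨f, Submodule.mem_span_singleton_self f⟩
  let S : ShortComplex (ModuleCat.{u} R) :=
    ShortComplex.mk (X₁ := ModuleCat.of R (LinearMap.ker π)) (X₂ := ModuleCat.of R P) (X₃ := Y)
      (ModuleCat.ofHom (LinearMap.ker π).subtype) (ModuleCat.ofHom π) (by ext x; exact x.2)
  have hS : S.ShortExact :=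
    { exact := by
        rw [ShortComplex.ShortExact.moduleCat_exact_iff_function_exact]
        exact LinearMap.exact_subtype_ker_map π
      mono_f := (ModuleCat.mono_iff_injective _).2 Subtype.val_injective
      epi_g := (ModuleCat.epi_iff_surjective _).2 hπ }
  have hK : ∀ φ : S.X₁ ⟶ V, φ = 0 := fun φ => by
    by_contra hφ
    have hφ' : φ.hom ≠ 0 := fun h0 => hφ (ModuleCat.hom_ext h0)
    obtain ⟨x, rfl⟩ := LinearMap.surjective_of_ne_zero hφ' v
    refine hv ?_
    rw [← map_smul, show f' • x = 0 from Subtype.ext (hf' _), map_zero]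
  have : Projective S.X₂ := (ModuleCat.of R P).projective_of_categoryTheory_projective
  -- A class in `Ext¹(Y, V)` becomes zero on the projective `P`, so it is the image of a
  -- homomorphism from the kernel to `V`, which is zero.
  refine subsingleton_of_forall_eq 0 fun x => ?_
  obtain ⟨z, rfl⟩ := Abelian.Ext.contravariant_sequence_exact₃ hS V x
    (Abelian.Ext.eq_zero_of_projective _) (add_zero 1)
  rw [← Abelian.Ext.mk₀_addEquiv₀_apply z, hK (Abelian.Ext.addEquiv₀ z), Abelian.Ext.mk₀_zero,
    Abelian.Ext.comp_zero]

/-! ### Linear characters and eigenvectors. -/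

section Linear

variable {k : Type u} [Field k] {H : Type v} [Group H]

/-- An irreducible representation of a finite commutative group over an algebraically closed field
is one-dimensional, so it is given by a linear character. -/
theorem exists_character_of_isIrreducible [IsAlgClosed k] [Finite H] [IsMulCommutative H]
    (X : Rep.{w} k H) (hX : X.ρ.IsIrreducible) :
    ∃ (χ : H →* k) (x : X), x ≠ 0 ∧ (∀ z : X, ∃ c : k, c • x = z) ∧
      ∀ t z, X.ρ t z = χ t • z := by
  have : IsSimpleModule k[H] X.ρ.asModule := inferInstance
  have : Module.Finite k k[H] := Module.Finite.of_basis (MonoidAlgebra.basis H k)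
  have : Module.Finite k X.ρ.asModule := Module.Finite.trans k[H] X.ρ.asModule
  have : Module.Finite k X := Module.Finite.equiv X.ρ.asModuleEquiv
  have h1 : Module.finrank k X =
      1 := Representation.IsIrreducible.finrank_eq_one_of_isMulCommutative X.ρ
  obtain ⟨x, hx, hx'⟩ := finrank_eq_one_iff'.1 h1
  choose χ hχ using fun t => hx' (X.ρ t x)
  have hz : ∀ t z, X.ρ t z = χ t • z := fun t z => by
    obtain ⟨c, rfl⟩ := hx' z
    rw [map_smul, ← hχ, smul_comm]
  refine ⟨⟨⟨χ, ?_⟩, fun s t => ?_⟩, x, hx, hx', hz⟩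
  · exact smul_left_injective k hx (by simp [hχ])
  · refine smul_left_injective k hx ?_
    change χ (s * t) • x = (χ s * χ t) • x
    rw [hχ, map_mul, Module.End.mul_apply, hz, hz, mul_smul]

/-- The last nonzero iterate of `N` on `v` serves; it keeps `q` because `N` does. -/
theorem exists_ne_zero_apply_eq_zero_of_pow {M : Type w} [AddCommGroup M] [Module k M]
    (N : Module.End k M) {q : M → Prop} (hq : ∀ v, q v → q (N v)) {v : M} (hv : q v) (hv0 : v ≠ 0)
    {j : ℕ} (hj : (N ^ j) v = 0) : ∃ v, q v ∧ v ≠ 0 ∧ N v = 0 := by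
  induction j generalizing v with
  | zero => exact absurd hj hv0
  | succ j ih =>
    by_cases h : N v = 0
    · exact ⟨v, hv, hv0, h⟩
    · exact ih (hq v hv) h (by rwa [pow_succ] at hj)

end Linear

section Action

variable {k : Type u} [Field k] {G : Type v} [Group G] [Finite G] {H : Subgroup G}
  {M : Type w} [AddCommGroup M] [Module k M]

theorem asAlgebraHom_charIdem_of_eigenvector (ρ : Representation k G M) (χ : H →* k)
    (hH : (Nat.card H : k) ≠ 0) {y : M} (hy : ∀ h : H, ρ h y = χ h • y) :
    ρ.asAlgebraHom (charIdem H χ) y = y := by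
  let := Fintype.ofFinite H
  simp only [charIdem, map_smul, map_sum, Representation.asAlgebraHom_of, LinearMap.smul_apply,
    LinearMap.sum_apply, hy, smul_smul, ← map_mul]
  simp [← Nat.card_eq_fintype_card, ← Nat.cast_smul_eq_nsmul k, smul_smul, hH]

end Action

/-! ### Composition factors of `Y^U` and nonvanishing of the idempotents. -/

namespace BNPair.IsSplit

variable {k : Type u} [Field k] {G : Type v} [Group G] [Finite G] {D : BNPair G} {p : ℕ}
  (hD : D.IsSplit p) (m : ℕ)

theorem borelIdem_ne_zero_of_isCompositionFactor (hU : (Nat.card (D.U p) : k) ≠ 0)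
    (hT : (Nat.card (hD.torsion m) : k) ≠ 0) {X : Rep.{w} k D.T} {χ : D.T →* k}
    (hχ : ∀ t z, X.ρ t z = χ t • z) (Y : Rep.{w} k G)
    (h : IsCompositionFactor X (hcRestriction p D.T_le_B Y)) :
    ∃ y, Y.ρ.asAlgebraHom (hD.borelIdem m χ) y ≠ 0 := by
  obtain ⟨hX, A, f, hf⟩ := h
  have : IsSimpleModule k[D.T] X.ρ.asModule := inferInstance
  have : Nontrivial X := IsSimpleModule.nontrivial k[D.T] X.ρ.asModule
  obtain ⟨x, hx⟩ := exists_ne (0 : X)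
  obtain ⟨a, rfl⟩ := hf x
  let := Fintype.ofFinite (hD.torsion m)
  let i : hD.torsion m → D.T := Subgroup.inclusion (hD.torsion_le m)
  -- The torus idempotent applied to `a` inside `A`. Its image under `f` is still `f a`, as `T` acts
  -- on `X` through `χ`; so a vanishing projection in `Y` would give `f a = 0`.
  let a' : A.toSubmodule := (Nat.card (hD.torsion m) : k)⁻¹ •
    ∑ t : hD.torsion m, χ (i t⁻¹) • A.toRepresentation (i t) a
  have hfa : ∀ t, f (A.toRepresentation t a) = χ t • f a := fun t => by
    rw [← hχ]
    exact LinearMap.congr_fun (f.isIntertwining' t) a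
  have ha' : f a' = f a := by
    simp only [a', map_smul, map_sum, hfa, smul_smul, ← map_mul]
    have : ∀ t : hD.torsion m, i t⁻¹ * i t = 1 := fun t => Subtype.ext (inv_mul_cancel (t : G))
    simp [this, ← Nat.card_eq_fintype_card, ← Nat.cast_smul_eq_nsmul k, smul_smul, hT]
  let ι : A.toSubmodule →ₗ[k] Y := (Representation.invariants
    (((Rep.res D.B.subtype Y).ρ).comp (pCore p D.B).subtype)).subtype ∘ₗ A.toSubmodule.subtype
  have hι : ∀ t : hD.torsion m, ι (A.toRepresentation (i t) a) = Y.ρ t (ι a) := fun _ => rfl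
  have hιa : Y.ρ.asAlgebraHom (unipIdem D p k) (ι a) = ι a := by
    refine asAlgebraHom_charIdem_of_eigenvector Y.ρ 1 hU fun x => ?_
    obtain ⟨_, x, hx, rfl⟩ := x
    rw [MonoidHom.one_apply, one_smul]
    exact a.1.2 ⟨x, hx⟩
  refine ⟨ι a, fun h0 => hx ?_⟩
  have hιa' : ι a' = 0 := by
    rw [← h0, borelIdem, map_mul, Module.End.mul_apply, hιa]
    simp only [a', torusIdem, charIdem, map_smul, map_sum, hι, Representation.asAlgebraHom_of,
      LinearMap.smul_apply, LinearMap.sum_apply]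
    rfl
  rw [← ha', show a' = 0 from Subtype.ext (Subtype.ext hιa'), map_zero]

/-- If the projection of `Y` to the block of `χ` in `Y^U` does not vanish, then `χ` is afforded by a
vector of `Y^U`. -/
theorem exists_eigenvector {r a : ℕ} (hr : r.Prime) [CharP k r]
    (ha : ∀ t ∈ D.T, t ^ r ^ a ∈ hD.torsion m) {χ : D.T →* k} {M : Type w} [AddCommGroup M]
    [Module k M] (ρ : Representation k G M) {y : M} (hy : ρ.asAlgebraHom (hD.borelIdem m χ) y ≠ 0) :
    ∃ v : M, v ≠ 0 ∧ (∀ x ∈ D.U p, ρ x v = v) ∧ ∀ t : D.T, ρ t v = χ t • v := by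
  classical
  let := Fintype.ofFinite D.T
  have := Fact.mk hr
  -- The elements of `T` are treated one at a time. The condition on the torsion is carried along
  -- because it makes each `ρ t - χ t` nilpotent on the current vector.
  suffices ∀ s : Finset D.T, ∃ v : M, ((∀ x ∈ D.U p, ρ x v = v) ∧
      (∀ t : D.T, (t : G) ∈ hD.torsion m → ρ t v = χ t • v) ∧
      ∀ t ∈ s, ρ t v = χ t • v) ∧ v ≠ 0 by
    obtain ⟨v, ⟨h1, -, h2⟩, h3⟩ := this Finset.univ
    exact ⟨v, h3, h1, fun t => h2 t (Finset.mem_univ t)⟩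
  intro s
  induction s using Finset.induction_on with
  | empty =>
    refine ⟨_, ⟨fun x hx => ?_, fun t ht => ?_, by simp⟩, hy⟩
    · rw [← Representation.asAlgebraHom_of, ← Module.End.mul_apply, ← map_mul,
        of_mul_borelIdem _ _ hx]
    · rw [← Representation.asAlgebraHom_of, ← Module.End.mul_apply, ← map_mul, borelIdem,
        ← mul_assoc, torusIdem, of_mul_charIdem _ (⟨t, ht⟩ : hD.torsion m), smul_mul_assoc,
        map_smul]
      rfl
  | insert t s _ ih =>
    obtain ⟨v, hv, hv0⟩ := ih
    let N : Module.End k M := ρ t - algebraMap k _ (χ t)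
    have hN : ∀ z, N z = ρ t z - χ t • z := fun z => rfl
    have hcomm : ∀ (t' : D.T) (z : M), ρ t' (ρ t z) = ρ t (ρ t' z) := fun t' z => by
      rw [← Module.End.mul_apply, ← map_mul, hD.comm _ t'.2 _ t.2, map_mul, Module.End.mul_apply]
    have hNe : ∀ (t' : D.T) (z : M), ρ t' z = χ t' • z → ρ t' (N z) = χ t' • N z :=
      fun t' z hz => by
        rw [hN, map_sub, map_smul, hcomm, hz, map_smul, smul_sub, smul_comm]
    -- In characteristic `r` the power `r ^ a` distributes over this difference of commuting
    -- operators, giving `ρ (t ^ r ^ a) - χ (t ^ r ^ a)`, which kills `v` since `t ^ r ^ a` is in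
    -- the torsion.
    have hpow : (N ^ r ^ a) v = 0 := by
      have : Nontrivial M := ⟨v, 0, hv0⟩
      have : CharP (Module.End k M) r :=
        charP_of_injective_algebraMap (FaithfulSMul.algebraMap_injective k (Module.End k M)) r
      rw [sub_pow_char_pow_of_commute _ _ (Algebra.commutes _ _).symm, ← map_pow, ← map_pow,
        ← map_pow, LinearMap.sub_apply, sub_eq_zero]
      exact hv.2.1 (t ^ r ^ a) (ha t t.2)
    have hNU : ∀ z, (∀ x ∈ D.U p, ρ x z = z) → ∀ x ∈ D.U p, ρ x (N z) = N z := by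
      intro z hz x hx
      have hx' : (t : G)⁻¹ * x * t ∈ D.U p := by
        simpa using conj_mem_U (inv_mem t.2.1) hx
      have : ρ x (ρ t z) = ρ t z := by
        conv_rhs => rw [← hz _ hx']
        simp only [← Module.End.mul_apply, ← map_mul]
        congr 2; group
      rw [hN, map_sub, map_smul, this, hz x hx]
    obtain ⟨v', hv', hv0', hNv'⟩ := exists_ne_zero_apply_eq_zero_of_pow N
      (q := fun v => (∀ x ∈ D.U p, ρ x v = v) ∧
        (∀ t : D.T, (t : G) ∈ hD.torsion m → ρ t v = χ t • v) ∧ ∀ t ∈ s, ρ t v = χ t • v)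
      (fun z hz => ⟨hNU z hz.1, fun t' ht' => hNe t' z (hz.2.1 t' ht'),
        fun t' ht' => hNe t' z (hz.2.2 t' ht')⟩) hv hv0 hpow
    refine ⟨v', ⟨hv'.1, hv'.2.1, fun t' ht' => ?_⟩, hv0'⟩
    rcases Finset.mem_insert.1 ht' with rfl | ht'
    · rwa [hN, sub_eq_zero] at hNv'
    · exact hv'.2.2 t' ht'

theorem isCompositionFactor_of_borelIdem_ne_zero {r a : ℕ} (hr : r.Prime) [CharP k r]
    (ha : ∀ t ∈ D.T, t ^ r ^ a ∈ hD.torsion m) {X : Rep.{w} k D.T} (hX : X.ρ.IsIrreducible)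
    {χ : D.T →* k} {x : X} (hx : ∀ z : X, ∃ c : k, c • x = z)
    (hχ : ∀ t z, X.ρ t z = χ t • z) (Y : Rep.{w} k G) {y : Y}
    (hy : Y.ρ.asAlgebraHom (hD.borelIdem m χ) y ≠ 0) :
    IsCompositionFactor X (hcRestriction p D.T_le_B Y) := by
  obtain ⟨v, hv0, hvU, hvT⟩ := hD.exists_eigenvector m hr ha Y.ρ hy
  let M := hcRestriction p D.T_le_B Y
  let A : Subrepresentation M.ρ :=
    { toSubmodule :=
        { carrier := {z | ∀ t, M.ρ t z = χ t • z}
          add_mem' := fun hz hz' t => by rw [map_add, hz, hz', smul_add]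
          zero_mem' := fun t => by rw [map_zero, smul_zero]
          smul_mem' := fun c z hz t => by rw [map_smul, hz, smul_comm] }
      apply_mem_toSubmodule := fun g z hz t => by
        rw [hz g, map_smul, hz t, smul_comm] }
  let v₁ : M := (⟨v, fun b => hvU _ ⟨b.1, b.2, rfl⟩⟩ : Representation.invariants
    (((Rep.res D.B.subtype Y).ρ).comp (pCore p D.B).subtype))
  let v₂ : A.toSubmodule := ⟨v₁, fun t => Subtype.ext (hvT t)⟩
  have hv₂ : v₂ ≠ 0 := fun h => hv0 (congrArg (fun z : A.toSubmodule => z.1.1) h)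
  -- `T` acts by the same scalars `χ t` on the eigenspace `A` and on the line `X`, so any linear map
  -- between them intertwines; one with `φ v₂ = 1` is onto.
  obtain ⟨φ, hφ⟩ := Module.Projective.exists_dual_eq_one k hv₂
  refine ⟨hX, A, (φ.smulRight x).intertwiningMap_of_isIntertwiningMap _ _ fun t z => ?_,
    fun z => ?_⟩
  · have : A.toRepresentation t z = χ t • z := Subtype.ext (z.2 t)
    rw [this, map_smul, hχ]
  · obtain ⟨c, rfl⟩ := hx z
    refine ⟨c • v₂, ?_⟩
    change φ (c • v₂) • x = c • x
    rw [map_smul, hφ, smul_eq_mul, mul_one]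

theorem exists_borelIdem_conjChar_ne_zero (hp : p.Prime) (hU : (Nat.card (D.U p) : k) ≠ 0)
    (hT : (Nat.card (hD.torsion m) : k) ≠ 0) {M : Type w} [AddCommGroup M] [Module k M]
    (ρ : Representation k G M) (n : D.N) (χ : D.T →* k)
    (h : ∃ y, ρ.asAlgebraHom (hD.borelIdem m χ) y ≠ 0) :
    ∃ y, ρ.asAlgebraHom (hD.borelIdem m (conjChar n χ)) y ≠ 0 := by
  induction n using N_induction with
  | torus t ht => rwa [hD.conjChar_of_mem_T ht]
  | mul s n hs ih =>
    rw [conjChar_mul]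
    set ψ := conjChar n χ
    obtain ⟨y, hy⟩ := ih
    by_cases hψ : hD.resChar m ψ = hD.resChar m (conjChar s ψ)
    · refine ⟨y, ?_⟩
      rwa [borelIdem, torusIdem, ← hψ]
    · obtain ⟨a, ha, hquad⟩ := hD.borelIdem_quadratic m hp hs hU hT hψ
      -- If the idempotent of the reflected character killed `s u y`, with `u` the average over `U`,
      -- then `u s f_ψ y = 0`. The quadratic relation would then give `s² f_ψ y = 0`, and `f_ψ y =
      -- 0` as `s²` is invertible.
      refine ⟨ρ s (ρ.asAlgebraHom (unipIdem D p k) y), fun h0 => hy ?_⟩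
      have h1 : unipIdem D p k * of k G s * hD.borelIdem m ψ =
          hD.borelIdem m (conjChar s ψ) * of k G s * unipIdem D p k := by
        rw [borelIdem, borelIdem, mul_assoc, ← mul_assoc (of k G (s : G)), of_mul_torusIdem,
          (hD.commute_torusIdem_unipIdem m _).eq]
        simp only [mul_assoc]
      have h2 : ρ.asAlgebraHom (unipIdem D p k * of k G s * hD.borelIdem m ψ) y = 0 := by
        rw [h1, map_mul, map_mul, Module.End.mul_apply, Module.End.mul_apply,
          Representation.asAlgebraHom_of, h0]
      have h3 : ρ.asAlgebraHom (a • (of k G (s * s : G) * hD.borelIdem m ψ)) y = 0 := by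
        rw [← hquad, mul_assoc, mul_assoc, ← mul_assoc (unipIdem D p k), map_mul,
          Module.End.mul_apply, h2, map_zero]
      rw [map_smul, LinearMap.smul_apply, smul_eq_zero_iff_right ha, map_mul, Module.End.mul_apply,
        Representation.asAlgebraHom_of] at h3
      have := congrArg (ρ (s * s : G)⁻¹) h3
      rwa [Representation.inv_self_apply, map_zero] at this

end BNPair.IsSplit

theorem corollary4p3 {k : Type u} [Field k] [IsAlgClosed k] {G : Type v} [Group G] [Finite G]
    (p r : ℕ) (hp : p.Prime) [CharP k r] (hr : 0 < r) (hrp : r ≠ p)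
    (D : BNPair G) (hD : D.IsSplit p)
    (X X' : Rep.{max u v} k D.T) (hX : X.ρ.IsIrreducible) (hX' : X'.ρ.IsIrreducible)
    (hne : principalSeries p D X ≠ principalSeries p D X')
    (Y V : Rep.{max u v} k G) (hY : Y ∈ principalSeries p D X) (hV : V ∈ principalSeries p D X') :
    Subsingleton (Abelian.Ext.{max u v} (ModuleCat.of k[G] Y.ρ.asModule)
      (ModuleCat.of k[G] V.ρ.asModule) 1) := by
  have hr' : r.Prime := (CharP.char_is_prime_or_zero k r).resolve_right hr.ne'
  have : IsMulCommutative D.T := ⟨⟨fun a b => Subtype.ext (hD.comm a a.2 b b.2)⟩⟩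
  obtain ⟨χ, x, -, hx, hχ⟩ := exists_character_of_isIrreducible X hX
  obtain ⟨ψ, x', -, hx', hψ⟩ := exists_character_of_isIrreducible X' hX'
  obtain ⟨a, m, hm, hcard⟩ :=
    Nat.exists_eq_pow_mul_and_not_dvd (Nat.card_pos (α := D.T)).ne' r hr'.ne_one
  have ha : ∀ t ∈ D.T, t ^ r ^ a ∈ hD.torsion m := fun t ht => ⟨D.T.pow_mem ht _, by
    rw [← pow_mul, ← hcard]
    exact congrArg (fun z : D.T => (z : G)) (pow_card_eq_one' (x := (⟨t, ht⟩ : D.T)))⟩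
  have hU : (Nat.card (D.U p) : k) ≠ 0 :=
    natCast_ne_zero_of_isPGroup hp hr' hrp (BNPair.isPGroup_U hp)
  have hT : (Nat.card (hD.torsion m) : k) ≠ 0 :=
    BNPair.natCast_card_torsion_ne_zero hr' hD ((CharP.cast_eq_zero_iff k r m).not.2 hm)
  have hconj : ∀ n : D.N, hD.resChar m ψ ≠ hD.resChar m (BNPair.conjChar n χ) := by
    intro n h
    have hn : hD.borelIdem m ψ = hD.borelIdem m (BNPair.conjChar n χ) := by
      rw [BNPair.IsSplit.borelIdem, BNPair.IsSplit.torusIdem, h]; rfl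
    -- Irreducibility and the minimality of `T` do not involve the character, so only the
    -- composition factor condition has to be compared.
    refine hne (Set.ext fun Z => and_congr_right fun _ => and_congr_right fun _ => ⟨fun hZ => ?_,
      fun hZ => ?_⟩)
    · obtain ⟨y, hy⟩ := hD.exists_borelIdem_conjChar_ne_zero m hp hU hT Z.ρ n χ
        (hD.borelIdem_ne_zero_of_isCompositionFactor m hU hT hχ Z hZ)
      rw [← hn] at hy
      exact hD.isCompositionFactor_of_borelIdem_ne_zero m hr' ha hX' hx' hψ Z hy
    · obtain ⟨y, hy⟩ := hD.exists_borelIdem_conjChar_ne_zero m hp hU hT Z.ρ n⁻¹ _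
        (hn ▸ hD.borelIdem_ne_zero_of_isCompositionFactor m hU hT hψ Z hZ)
      rw [← BNPair.conjChar_mul, inv_mul_cancel, hD.conjChar_of_mem_T (D.T.one_mem)] at hy
      exact hD.isCompositionFactor_of_borelIdem_ne_zero m hr' ha hX hx hχ Z hy
  have hYs := hY.1
  have hVs := hV.1
  have : IsSimpleModule k[G] (ModuleCat.of k[G] Y.ρ.asModule) :=
    (Representation.irreducible_iff_isSimpleModule_asModule Y.ρ).1 hYs
  have : IsSimpleModule k[G] (ModuleCat.of k[G] V.ρ.asModule) :=
    (Representation.irreducible_iff_isSimpleModule_asModule V.ρ).1 hVs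
  obtain ⟨y, hy⟩ := hD.borelIdem_ne_zero_of_isCompositionFactor m hU hT hχ Y hY.2.2
  obtain ⟨v, hv⟩ := hD.borelIdem_ne_zero_of_isCompositionFactor m hU hT hψ V hV.2.2
  exact subsingleton_ext_one_of_idempotent (hD.borelIdem_mul_self m (χ := χ) hU hT)
    (hD.borelIdem_mul_mul_borelIdem m hconj) (ModuleCat.of k[G] Y.ρ.asModule)
    (ModuleCat.of k[G] V.ρ.asModule) (y := y) hy (v := v) hv
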